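/- Permutations are written in one-line notation $\sigma=\sigma_1\cdots\sigma_n$ ($n\ge 1$). A \emph{double ascent} is a permutation having at most one consecutive inversion, i.e. at most one pair of adjacent entries $(\sigma_i,\sigma_{i+1})$ with $\sigma_{i+1}<\sigma_i$. The set $\mathcal{DA}$ of all double ascents is ordered by the \emph{consecutive order} (with respect to values): for $\sigma$ of length $n$ and $\rho$ of length $m$, $\sigma\le\rho$ if and only if there is a map $f:[1,n]\to[1,m]$ with $f(k)=f(1)+k-1$ for all $k$ such that the subsequence of $\rho$ consisting of the entries with values in $f([1,n])$ has the same length and the same relative order of entries as $\sigma$. For $B\subseteq\mathcal{DA}$ let $\mathrm{Av}(B)=\{\sigma\in\mathcal{DA} : \beta\not\le\sigma\text{ for all }\beta\in B\}$. A downward closed subset $Y\subseteq\mathcal{DA}$ is \emph{atomic} if it cannot be written as $Y=U\cup V$ with $U,V$ downward closed proper subsets of $Y$. \textbf{Theorem.} It is decidable whether a finitely based avoidance set of double ascents under the consecutive order is atomic. That is, there is an algorithm (a total computable function) which, given the one-line notations of the elements of any finite set $B$ of double ascents as a list, decides whether $\mathrm{Av}(B)$ is atomic. -/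

import Mathlib

namespace ConsecutiveOrder

/-- A (nonempty) permutation in one-line notation: a sequence `σ₁ … σₙ` with `n ≥ 1` in which
each of the numbers `1, …, n` occurs exactly once. -/
def IsPermutation (σ : List ℕ) : Prop :=
  σ ≠ [] ∧ σ.Perm (List.range' 1 σ.length)

/-- `(a, b)` is a consecutive inversion of `σ`: `a` and `b` are adjacent entries of `σ`, in this
order, and `b ≤ a`. -/
def IsConsecutiveInversion (σ : List ℕ) (p : ℕ × ℕ) : Prop :=
  [p.1, p.2] <:+: σ ∧ p.2 ≤ p.1

/-- A double ascent is a permutation with at most one consecutive inversion. -/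
def IsDoubleAscent (σ : List ℕ) : Prop :=
  IsPermutation σ ∧ {p : ℕ × ℕ | IsConsecutiveInversion σ p}.encard ≤ 1

/-- Two sequences of distinct numbers are isomorphic if they have the same length and their
entries are in the same relative order. -/
def SeqIso (τ η : List ℕ) : Prop :=
  ∃ h : τ.length = η.length, ∀ i j : Fin τ.length,
    τ.get i < τ.get j ↔ η.get (i.cast h) < η.get (j.cast h)

/-- The restriction of a sequence to the entries whose values lie in `X`. -/
def restrict (τ : List ℕ) (X : Finset ℕ) : List ℕ :=
  τ.filter (fun x => x ∈ X)

/-- `f` restricts to a contiguous map `[1, n] → [1, m]` (for the natural order of values):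
`f k = f 1 + k - 1` for all `k` in `[1, n]`. -/
def IsContiguous (n m : ℕ) (f : ℕ → ℕ) : Prop :=
  ∀ k ∈ Finset.Icc 1 n, f k ∈ Finset.Icc 1 m ∧ f k + 1 = f 1 + k

/-- The consecutive order on permutations, with respect to the order of values. -/
def ConsecutiveLE (σ ρ : List ℕ) : Prop :=
  ∃ f : ℕ → ℕ, IsContiguous σ.length ρ.length f ∧
    SeqIso σ (restrict ρ ((Finset.Icc 1 σ.length).image f))

/-- The type of double ascents. -/
def DoubleAscent : Type := {σ : List ℕ // IsDoubleAscent σ}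

/-- The one-line notation of a double ascent. -/
def DoubleAscent.oneLine (σ : DoubleAscent) : List ℕ := σ.1

/-- Double ascents are ordered by the consecutive order. -/
instance : LE DoubleAscent := ⟨fun σ ρ => ConsecutiveLE σ.oneLine ρ.oneLine⟩

/-- The avoidance set of `B`. -/
def Av {α : Type*} [LE α] (B : Set α) : Set α := {x | ∀ b ∈ B, ¬ b ≤ x}

/-- A downward closed set is atomic if it is not the union of two downward closed proper
subsets. -/
def IsAtomicSet {α : Type*} [LE α] (Y : Set α) : Prop :=
  IsLowerSet Y ∧
    ¬ ∃ U V : Set α, IsLowerSet U ∧ IsLowerSet V ∧ U ⊂ Y ∧ V ⊂ Y ∧ Y = U ∪ V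

end ConsecutiveOrder

/-! Record a double ascent as a binary word whose `i`-th letter says whether the value `i` lies in
the first or the second increasing run. Intervals of values become factors, so the consecutive order
becomes the factor order on words (`consecutiveLE_wordPerm_iff`). The code is unique except for
increasing permutations, which are encoded by all words consisting of a block of `true` followed by
a block of `false` (`eq_of_wordPerm_eq`).

A downward closed set is atomic iff it is directed, so the question is whether any two words
avoiding `B` are contained in a common word avoiding `B`. Let `b` bound the lengths in `B`. Having
the same prefixes, suffixes and factors of length at most `b` is a congruence of finite index that
respects avoidance, so every word shrinks to an equivalent one of computably bounded length
(`exists_localEquiv_length_le`).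

It suffices to test short words (`jointlyContained_of_short`). For `x` and `y` with descents, join
short equivalents inside some `z` and put `x` and `y` back: this gives extensions of `x` and of `y`
that are both equivalent to `z`. Equivalent words can then be joined (`joinable_of_localEquiv`). Let
`s` and `t` be their common first and last `b` letters. If some avoiding word leads from `t` to `s`,
chain the two words. Otherwise every common avoiding extension superimposes their last occurrences
of `s`. A disagreement on either side would survive shrinking the pieces around it and produce a
short pair that cannot be joined; so there is none, and the words glue along `s`.

Increasing permutations are fitted in by stretching a constant block. The common word may itself be
shrunk, so the test is a bounded, primitive recursive search. -/

namespace ConsecutiveOrder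

/-! ### Words, avoidance and local equivalence. -/

section Words

variable {α : Type*}

/-- A word avoids `F` if none of its factors satisfies `F`. -/
def Avoids (F : List α → Prop) (w : List α) : Prop := ∀ u, u <:+: w → ¬ F u

/-- Two words are locally equivalent at scale `b` if they have the same prefixes, suffixes and
factors of length at most `b`. -/
def LocalEquiv (b : ℕ) (x y : List α) : Prop :=
  ∀ u : List α, u.length ≤ b →
    (u <+: x ↔ u <+: y) ∧ (u <:+ x ↔ u <:+ y) ∧ (u <:+: x ↔ u <:+: y)

theorem prefix_append_iff {u p x : List α} :
    u <+: p ++ x ↔ u <+: p ∨ ∃ v, u = p ++ v ∧ v <+: x := by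
  constructor
  · intro h
    rcases le_total u.length p.length with hl | hl
    · exact Or.inl (List.prefix_of_prefix_length_le h (List.prefix_append _ _) hl)
    · obtain ⟨v, rfl⟩ := List.prefix_of_prefix_length_le (List.prefix_append p x) h hl
      exact Or.inr ⟨v, rfl, (List.prefix_append_right_inj _).1 h⟩
  · rintro (h | ⟨v, rfl, h⟩)
    · exact h.trans (List.prefix_append _ _)
    · exact (List.prefix_append_right_inj _).2 h

theorem suffix_append_iff {u p x : List α} :
    u <:+ p ++ x ↔ u <:+ x ∨ ∃ v, u = v ++ x ∧ v <:+ p := by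
  constructor
  · intro h
    rcases le_total u.length x.length with hl | hl
    · exact Or.inl (List.suffix_of_suffix_length_le h (List.suffix_append _ _) hl)
    · obtain ⟨v, rfl⟩ := List.suffix_of_suffix_length_le (List.suffix_append p x) h hl
      exact Or.inr ⟨v, rfl, List.suffix_append_self_iff.1 h⟩
  · rintro (h | ⟨v, rfl, h⟩)
    · exact h.trans (List.suffix_append _ _)
    · exact List.suffix_append_self_iff.2 h

theorem Avoids.of_infix {F : List α → Prop} {x y : List α} (h : Avoids F y) (hxy : x <:+: y) :
    Avoids F x := fun u hu => h u (hu.trans hxy)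

namespace LocalEquiv

variable {b : ℕ} {x y z : List α}

@[refl] theorem refl (b : ℕ) (x : List α) : LocalEquiv b x x := fun _ _ => by simp

@[symm] theorem symm (h : LocalEquiv b x y) : LocalEquiv b y x :=
  fun u hu => ⟨(h u hu).1.symm, (h u hu).2.1.symm, (h u hu).2.2.symm⟩

theorem trans (h : LocalEquiv b x y) (h' : LocalEquiv b y z) : LocalEquiv b x z :=
  fun u hu => ⟨(h u hu).1.trans (h' u hu).1, (h u hu).2.1.trans (h' u hu).2.1,
    (h u hu).2.2.trans (h' u hu).2.2⟩

theorem append_left (p : List α) (h : LocalEquiv b x y) : LocalEquiv b (p ++ x) (p ++ y) := by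
  intro u hu
  refine ⟨?_, ?_, ?_⟩
  · simp only [prefix_append_iff]
    refine or_congr_right (exists_congr fun v => and_congr_right fun hv => ?_)
    subst hv
    exact (h v (by simp at hu; omega)).1
  · suffices H : ∀ {x y : List α}, LocalEquiv b x y → u <:+ p ++ x → u <:+ p ++ y from
      ⟨H h, H h.symm⟩
    intro x y h hx
    rcases suffix_append_iff.1 hx with hx | ⟨v, rfl, hv⟩
    · exact suffix_append_iff.2 (Or.inl ((h u hu).2.1.1 hx))
    · have hxb : x.length ≤ b := by simp at hu; omega
      have hxy : x <:+ y := (h x hxb).2.1.1 List.suffix_rfl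
      rcases eq_or_ne v [] with rfl | hv0
      · exact hxy.trans (List.suffix_append _ _)
      have hv1 := List.length_pos_iff.2 hv0
      simp only [List.length_append] at hu
      -- Here `v` is nonempty, so `x` is shorter than `b`, and its class at scale `b` contains no
      -- other word.
      have hyx : y = x := by
        rcases le_total y.length b with hy | hy
        · exact (List.IsSuffix.eq_of_length_le ((h y hy).2.1.2 List.suffix_rfl) hxy.length_le)
        · have h1 : (y.drop (y.length - b)).length = b := by simp; omega
          have h2 := (h _ h1.le).2.1.2 (List.drop_suffix _ _)
          have h3 := h2.length_le
          omega
      rw [hyx]; exact hx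
  · simp only [List.infix_append_iff]
    refine or_congr_right (or_congr (h u hu).2.2 ?_)
    refine exists_congr fun v => exists_congr fun v' => and_congr_right fun hv =>
      and_congr_right fun _ => ?_
    subst hv
    exact (h v' (by simp at hu; omega)).1

theorem reverse (h : LocalEquiv b x y) : LocalEquiv b x.reverse y.reverse := by
  intro u hu
  have := h u.reverse (by simpa using hu)
  refine ⟨?_, ?_, ?_⟩
  · rw [← List.reverse_reverse u, List.reverse_prefix, List.reverse_prefix]; exact this.2.1
  · rw [← List.reverse_reverse u, List.reverse_suffix, List.reverse_suffix]; exact this.1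
  · rw [← List.reverse_reverse u, List.reverse_infix, List.reverse_infix]; exact this.2.2

theorem append_right (q : List α) (h : LocalEquiv b x y) : LocalEquiv b (x ++ q) (y ++ q) := by
  simpa using (h.reverse.append_left q.reverse).reverse

theorem append {x' y' : List α} (h : LocalEquiv b x y) (h' : LocalEquiv b x' y') :
    LocalEquiv b (x ++ x') (y ++ y') := (h.append_right x').trans (h'.append_left y)

theorem cons (a : α) (h : LocalEquiv b x y) : LocalEquiv b (a :: x) (a :: y) :=
  h.append_left [a]

theorem avoids {F : List α → Prop} (hF : ∀ u, F u → u.length ≤ b) (h : LocalEquiv b x y)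
    (hx : Avoids F x) : Avoids F y :=
  fun u hu hFu => hx u ((h u (hF u hFu)).2.2.2 hu) hFu

theorem eq_of_length_lt (h : LocalEquiv b x y) (hx : x.length < b) : y = x := by
  have hxy : x <+: y := (h x hx.le).1.1 List.prefix_rfl
  rcases le_total y.length b with hy | hy
  · exact List.IsPrefix.eq_of_length_le ((h y hy).1.2 List.prefix_rfl) hxy.length_le
  · have h1 : (y.take b).length = b := by simp; omega
    have h3 := ((h _ h1.le).1.2 (List.take_prefix _ _)).length_le
    omega

end LocalEquiv

/-- A forbidden factor has length at most `b`, too short to meet both `p` and `q` across the overlap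
`v`. -/
theorem Avoids.glue {F : List α → Prop} {b : ℕ} (hF : ∀ u, F u → u.length ≤ b)
    {p v q : List α} (hv : b ≤ v.length) (h : Avoids F (p ++ v)) (h' : Avoids F (v ++ q)) :
    Avoids F (p ++ v ++ q) := by
  intro u hu hFu
  rw [List.append_assoc, List.infix_append_iff] at hu
  rcases hu with hu | hu | ⟨r, r', rfl, hr, hr'⟩
  · exact h u (hu.trans List.infix_append_left) hFu
  · exact h' u hu hFu
  · have hl := hF _ hFu
    have : r' <+: v := List.prefix_of_prefix_length_le hr' (List.prefix_append _ _)
      (by simp at hl; omega)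
    refine h _ ?_ hFu
    exact List.infix_append_iff.2 (Or.inr (Or.inr ⟨r, r', rfl, hr, this⟩))

/-! ### Joining locally equivalent words. -/

/-- Two words can be joined if they are factors of a common word that avoids `F`. -/
def Joinable (F : List α → Prop) (x y : List α) : Prop :=
  ∃ z, Avoids F z ∧ x <:+: z ∧ y <:+: z

theorem Joinable.symm {F : List α → Prop} {x y : List α} (h : Joinable F x y) :
    Joinable F y x := by
  obtain ⟨z, hz, hx, hy⟩ := h
  exact ⟨z, hz, hy, hx⟩

/-- The word `t` leads to the word `s` if some word avoiding `F` begins with `t` and ends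
with `s`. -/
def Leads (F : List α → Prop) (t s : List α) : Prop :=
  ∃ z, Avoids F z ∧ t <+: z ∧ s <:+ z

theorem Leads.joinable {F : List α → Prop} {b : ℕ} (hF : ∀ u, F u → u.length ≤ b)
    {s t x y : List α} (hts : Leads F t s) (ht : t.length = b) (hs : s.length = b)
    (hx : Avoids F x) (hy : Avoids F y) (hxt : t <:+ x) (hys : s <+: y) : Joinable F x y := by
  obtain ⟨_, hz, ⟨m, rfl⟩, ⟨m', hm⟩⟩ := hts
  obtain ⟨x', rfl⟩ := hxt
  obtain ⟨y', rfl⟩ := hys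
  have h1 : Avoids F (x' ++ t ++ m) := Avoids.glue hF ht.ge hx hz
  rw [List.append_assoc, ← hm, ← List.append_assoc] at h1
  have h2 := Avoids.glue hF hs.ge h1 hy
  refine ⟨_, h2, ?_, ?_⟩
  · rw [List.append_assoc x', hm]
    exact ⟨[], m ++ y', by simp⟩
  · exact ⟨x' ++ m', [], by simp⟩

theorem exists_last_occurrence {s : List α} (hs : s ≠ []) :
    ∀ {x : List α}, s <:+: x → ∃ x₁ h w, x = x₁ ++ h :: w ∧ s <+: h :: w ∧ ¬ s <:+: w
  | [], hx => by simp_all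
  | a :: x, hx => by
    by_cases h : s <:+: x
    · obtain ⟨x₁, c, w, rfl, h1, h2⟩ := exists_last_occurrence hs h
      exact ⟨a :: x₁, c, w, rfl, h1, h2⟩
    · exact ⟨[], a, x, rfl, (List.infix_cons_iff.1 hx).resolve_right h, h⟩

theorem not_prefix_decompose : ∀ {l l' : List α}, ¬ l <+: l' → ¬ l' <+: l →
    ∃ c a a' r r', l = c ++ a :: r ∧ l' = c ++ a' :: r' ∧ a ≠ a'
  | [], _, h, _ => by simp at h
  | _ :: _, [], _, h => by simp at h
  | a :: l, a' :: l', h, h' => by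
    by_cases e : a = a'
    · subst e
      obtain ⟨c, d, d', r, r', rfl, rfl, hd⟩ :=
        not_prefix_decompose (l := l) (l' := l') (by simpa using h) (by simpa using h')
      exact ⟨a :: c, d, d', r, r', rfl, rfl, hd⟩
    · exact ⟨[], a, a', l, l', rfl, rfl, e⟩

theorem not_suffix_decompose {l l' : List α} (h : ¬ l <:+ l') (h' : ¬ l' <:+ l) :
    ∃ c a a' r r', l = r ++ a :: c ∧ l' = r' ++ a' :: c ∧ a ≠ a' := by
  rw [← List.reverse_prefix] at h h'
  obtain ⟨c, a, a', r, r', h1, h2, hne⟩ := not_prefix_decompose h h'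
  refine ⟨c.reverse, a, a', r.reverse, r'.reverse, ?_, ?_, hne⟩
  · rw [← List.reverse_reverse l, h1]; simp
  · rw [← List.reverse_reverse l', h2]; simp

/-- If `t` does not lead to `s`, then within a word avoiding `F` the position of the last `s` of a
factor ending with `t` is determined. -/
theorem not_length_lt_of_not_leads {F : List α → Prop} {b : ℕ} {s t : List α}
    (hts : ¬ Leads F t s) (ht : t.length = b) (hs : s.length = b)
    {z p w q p' m' : List α} {h : α} (hz : Avoids F z)
    (e : z = p ++ h :: w ++ q) (e' : z = p' ++ s ++ m') (hsw : ¬ s <:+: w)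
    (htw : t <:+ h :: w) : ¬ p.length < p'.length := by
  intro hlt
  obtain ⟨g, hg⟩ := htw
  have hgl := congrArg List.length hg
  simp only [List.length_append, List.length_cons] at hgl
  -- Since `s` and `t` have equal length, an `s` starting before this `t` ends inside `w`, which
  -- contains no `s`; one starting at `t` or later shows that `t` leads to `s`.
  by_cases hc : p'.length < p.length + g.length
  · apply hsw
    have e1 : p ++ [h] ++ (w ++ q) = p' ++ (s ++ m') := by
      rw [← List.append_assoc p', ← e', e]; simp
    have : p ++ [h] <+: p' := List.prefix_of_prefix_length_le
      (e1 ▸ List.prefix_append _ _) (List.prefix_append _ _) (by simp; omega)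
    obtain ⟨k, rfl⟩ := this
    rw [List.append_assoc (p ++ [h]), List.append_cancel_left_eq] at e1
    have : k ++ s <+: w := List.prefix_of_prefix_length_le (l₃ := w ++ q)
      (by rw [e1]; exact ⟨m', by simp⟩) (List.prefix_append _ _)
      (by simp at hc ⊢; omega)
    exact (List.suffix_append k s).isInfix.trans this.isInfix
  · apply hts
    have e1 : p ++ g ++ (t ++ q) = p' ++ (s ++ m') := by
      rw [← List.append_assoc p', ← e', e, ← hg]; simp
    have : p ++ g <+: p' := List.prefix_of_prefix_length_le
      (e1 ▸ List.prefix_append _ _) (List.prefix_append _ _) (by simp; omega)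
    obtain ⟨k, rfl⟩ := this
    rw [List.append_assoc (p ++ g), List.append_cancel_left_eq] at e1
    refine ⟨k ++ s, hz.of_infix ⟨p ++ g, m', by rw [e']; simp⟩, ?_, List.suffix_append _ _⟩
    exact List.prefix_of_prefix_length_le (l₃ := k ++ (s ++ m'))
      (by rw [← e1]; exact List.prefix_append _ _) ⟨m', by simp⟩ (by simp; omega)

/-- The heart of the argument: if all short pairs of words with the locally invariant property `P`
are joinable, then so are any two locally equivalent words with this property. -/
theorem joinable_of_localEquiv {F : List α → Prop} {P : List α → Prop} {b K N : ℕ} (hb : 0 < b)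
    (hF : ∀ u, F u → u.length ≤ b)
    (hP : ∀ x y, LocalEquiv b x y → P x → P y)
    (hK : ∀ w : List α, ∃ w', LocalEquiv b w w' ∧ w'.length ≤ K)
    (hN : 3 * K + 2 ≤ N)
    (hJ : ∀ x y, Avoids F x → Avoids F y → P x → P y → x.length ≤ N → y.length ≤ N →
      Joinable F x y)
    {x y : List α} (hx : Avoids F x) (hPx : P x) (hxy : LocalEquiv b x y) :
    Joinable F x y := by
  have hy := hxy.avoids hF hx
  have hPy := hP x y hxy hPx
  rcases lt_or_ge x.length b with hlt | hge
  · rw [hxy.eq_of_length_lt hlt]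
    exact ⟨x, hx, List.infix_rfl, List.infix_rfl⟩
  obtain ⟨s, hsl, hsx⟩ : ∃ s, s.length = b ∧ s <+: x :=
    ⟨x.take b, by simpa using hge, List.take_prefix _ _⟩
  obtain ⟨t, htl, htx⟩ : ∃ t, t.length = b ∧ t <:+ x :=
    ⟨x.drop (x.length - b), by simp; omega, List.drop_suffix _ _⟩
  have hsy : s <+: y := (hxy s hsl.le).1.1 hsx
  have hty : t <:+ y := (hxy t htl.le).2.1.1 htx
  by_cases hts : Leads F t s
  · exact hts.joinable hF htl hsl hx hy htx hsy
  have hs0 : s ≠ [] := by rintro rfl; simp at hsl; omega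
  obtain ⟨x₁, h, w, ex, hsw, hnw⟩ := exists_last_occurrence hs0 hsx.isInfix
  obtain ⟨y₁, h', v, ey, hsv, hnv⟩ := exists_last_occurrence hs0 hsy.isInfix
  obtain rfl : h = h' := by
    obtain ⟨a, s', rfl⟩ := List.exists_cons_of_ne_nil hs0
    simp only [List.cons_prefix_cons] at hsw hsv
    exact hsw.1.symm.trans hsv.1
  have htail : ∀ {x₁ w : List α}, s <+: h :: w → t <:+ x₁ ++ h :: w → t <:+ h :: w :=
    fun hw hx => List.suffix_of_suffix_length_le hx (List.suffix_append _ _)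
      (by have := hw.length_le; omega)
  -- Stated for all short words equivalent to `x`, so that it applies to the shrunken copies of `x`
  -- and `y`. Neither last occurrence of `s` can lie to the right of the other, so the two coincide
  -- in `z`.
  have align : ∀ {x₁ w y₁ v : List α}, LocalEquiv b x (x₁ ++ h :: w) →
      LocalEquiv b x (y₁ ++ h :: v) → s <+: h :: w → s <+: h :: v → ¬ s <:+: w → ¬ s <:+: v →
      (x₁ ++ h :: w).length ≤ N → (y₁ ++ h :: v).length ≤ N →
      ∃ p q p' q', p ++ x₁ = p' ++ y₁ ∧ w ++ q = v ++ q' := by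
    intro x₁ w y₁ v hxx hxy hsw hsv hnw hnv hxN hyN
    obtain ⟨z, hz, ⟨p, q, e⟩, ⟨p', q', e'⟩⟩ := hJ _ _ (hxx.avoids hF hx) (hxy.avoids hF hx)
      (hP _ _ hxx hPx) (hP _ _ hxy hPx) hxN hyN
    have htw := htail hsw ((hxx t htl.le).2.1.1 htx)
    have htv := htail hsv ((hxy t htl.le).2.1.1 htx)
    obtain ⟨mw, hmw⟩ := hsw
    obtain ⟨mv, hmv⟩ := hsv
    have h1 := not_length_lt_of_not_leads hts htl hsl hz (p := p ++ x₁) (w := w) (q := q)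
      (h := h) (p' := p' ++ y₁) (m' := mv ++ q') (by simp [← e])
      (by rw [← e', ← hmv]; simp) hnw htw
    have h2 := not_length_lt_of_not_leads hts htl hsl hz (p := p' ++ y₁) (w := v) (q := q')
      (h := h) (p' := p ++ x₁) (m' := mw ++ q) (by simp [← e'])
      (by rw [← e, ← hmw]; simp) hnv htv
    have e2 : (p ++ x₁) ++ (h :: (w ++ q)) = (p' ++ y₁) ++ (h :: (v ++ q')) := by
      simpa using e.trans e'.symm
    obtain ⟨e3, e4⟩ := List.append_inj e2 (by omega)
    exact ⟨p, q, p', q', e3, List.tail_eq_of_cons_eq e4⟩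
  subst ex ey
  have hprefix : w <+: v ∨ v <+: w := by
    by_contra! hc
    obtain ⟨c, a, a', r, r', rfl, rfl, hne⟩ := not_prefix_decompose hc.1 hc.2
    -- The common part `c` is replaced by the same `c'` in both words, so the letters `a` and `a'`
    -- still face each other after alignment. Each word now has three pieces of length at most `K`
    -- and two single letters, whence `3 * K + 2`.
    obtain ⟨c', hc', hcK⟩ := hK c
    obtain ⟨r₁, hr₁, hr₁K⟩ := hK r
    obtain ⟨r₂, hr₂, hr₂K⟩ := hK r'
    obtain ⟨x₂, hx₂, hx₂K⟩ := hK x₁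
    obtain ⟨y₂, hy₂, hy₂K⟩ := hK y₁
    have ew := hc'.append (hr₁.cons a)
    have ev := hc'.append (hr₂.cons a')
    obtain ⟨p, q, p', q', _, e⟩ := align (hx₂.append (ew.cons h))
      (hxy.trans (hy₂.append (ev.cons h))) (((ew.cons h) s hsl.le).1.1 hsw)
      (((ev.cons h) s hsl.le).1.1 hsv) (mt (ew s hsl.le).2.2.2 hnw)
      (mt (ev s hsl.le).2.2.2 hnv) (by simp; omega) (by simp; omega)
    simp only [List.append_assoc, List.cons_append, List.append_cancel_left_eq,
      List.cons.injEq] at e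
    exact hne e.1
  have hsuffix : x₁ <:+ y₁ ∨ y₁ <:+ x₁ := by
    by_contra! hc
    obtain ⟨c, a, a', r, r', rfl, rfl, hne⟩ := not_suffix_decompose hc.1 hc.2
    obtain ⟨c', hc', hcK⟩ := hK c
    obtain ⟨r₁, hr₁, hr₁K⟩ := hK r
    obtain ⟨r₂, hr₂, hr₂K⟩ := hK r'
    obtain ⟨w', ew, hwK⟩ := hK w
    obtain ⟨v', ev, hvK⟩ := hK v
    obtain ⟨p, q, p', q', e, _⟩ := align ((hr₁.append (hc'.cons a)).append (ew.cons h))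
      (hxy.trans ((hr₂.append (hc'.cons a')).append (ev.cons h)))
      (((ew.cons h) s hsl.le).1.1 hsw)
      (((ev.cons h) s hsl.le).1.1 hsv) (mt (ew s hsl.le).2.2.2 hnw)
      (mt (ev s hsl.le).2.2.2 hnv) (by simp; omega) (by simp; omega)
    have e1 : (p ++ r₁) ++ (a :: c') = (p' ++ r₂) ++ (a' :: c') := by simpa using e
    have e2 := (List.append_inj' e1 (by simp)).2
    simp only [List.cons.injEq] at e2
    exact hne e2.1
  have glue : ∀ {x₁ w y₁ v : List α}, Avoids F (x₁ ++ h :: w) → Avoids F (y₁ ++ h :: v) →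
      s <+: h :: w → s <+: h :: v → w <+: v → (x₁ <:+ y₁ ∨ y₁ <:+ x₁) →
      Joinable F (x₁ ++ h :: w) (y₁ ++ h :: v) := by
    intro x₁ w y₁ v hx hy hsw hsv hwv hxy
    obtain ⟨k, rfl⟩ := hwv
    rcases hxy with ⟨g, rfl⟩ | ⟨g, rfl⟩
    · exact ⟨_, hy, ⟨g, k, by simp⟩, List.infix_rfl⟩
    -- The left part comes from the first word and the right part from the second; they overlap in
    -- `s`, of length `b`.
    · obtain ⟨mw, hmw⟩ := hsw
      have h1 : h :: (w ++ k) = s ++ (mw ++ k) := by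
        rw [← List.append_assoc, hmw]; rfl
      have hz : Avoids F ((g ++ y₁) ++ s ++ (mw ++ k)) :=
        Avoids.glue hF hsl.ge (hx.of_infix ⟨[], mw, by simp [← hmw]⟩)
          (hy.of_infix ⟨y₁, [], by simp [h1]⟩)
      rw [List.append_assoc, ← h1] at hz
      exact ⟨_, hz, ⟨[], k, by simp⟩, ⟨g, [], by simp⟩⟩
  rcases hprefix with hp | hp
  · exact glue hx hy hsw hsv hp hsuffix
  · exact (glue hy hx hsv hsw hp hsuffix.symm).symm

end Words

/-! ### Shrinking binary words. -/

/-- The list of all binary words of length at most `n`. -/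
def wordsUpTo : ℕ → List (List Bool)
  | 0 => [[]]
  | n + 1 => [] :: (wordsUpTo n).flatMap fun w => [true :: w, false :: w]

theorem mem_wordsUpTo : ∀ {n : ℕ} {w : List Bool}, w ∈ wordsUpTo n ↔ w.length ≤ n
  | 0, w => by simp [wordsUpTo]
  | n + 1, [] => by simp [wordsUpTo]
  | n + 1, a :: w => by
    simp only [wordsUpTo, List.mem_cons, List.mem_flatMap, reduceCtorEq, false_or,
      List.cons.injEq, List.not_mem_nil, or_false, List.length_cons, add_le_add_iff_right]
    rw [← mem_wordsUpTo]
    cases a <;> simp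

/-- Every binary word is locally equivalent at scale `b` to one of at most this length. -/
def pumpingBound (b : ℕ) : ℕ := 8 ^ (wordsUpTo b).length

theorem exists_localEquiv_length_le (b : ℕ) (w : List Bool) :
    ∃ w', LocalEquiv b w w' ∧ w'.length ≤ pumpingBound b := by
  classical
  induction hn : w.length using Nat.strong_induction_on generalizing w with
  | _ n ih =>
    subst hn
    rcases le_or_gt w.length (pumpingBound b) with h | h
    · exact ⟨w, .refl b w, h⟩
    -- Three bits per short word determine the class, whence the base 8. Two prefixes of a long word
    -- share a class, and the stretch between their ends can be cut out.
    let sig : List Bool → Fin (wordsUpTo b).length → Bool × Bool × Bool := fun x i =>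
      (decide ((wordsUpTo b)[i] <+: x), decide ((wordsUpTo b)[i] <:+ x),
        decide ((wordsUpTo b)[i] <:+: x))
    have hsig : ∀ x y, sig x = sig y → LocalEquiv b x y := by
      intro x y hxy u hu
      obtain ⟨i, hi, rfl⟩ := List.getElem_of_mem (mem_wordsUpTo.2 hu)
      have := congrFun hxy ⟨i, hi⟩
      simpa [sig] using this
    obtain ⟨i, j, hij, he⟩ := Fintype.exists_ne_map_eq_of_card_lt
      (fun i : Fin (w.length + 1) => sig (w.take i)) (by
        simp only [Fintype.card_fin, Fintype.card_pi, Fintype.card_prod, Fintype.card_bool,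
          Finset.prod_const, Finset.card_univ]
        exact Nat.lt_succ_of_lt h)
    wlog hlt : i < j generalizing i j
    · exact this j i hij.symm he.symm (lt_of_le_of_ne (not_lt.1 hlt) hij.symm)
    have hlt' : (i : ℕ) < j := hlt
    have hj := j.2
    have e : LocalEquiv b w (w.take i ++ w.drop j) := by
      have := (hsig _ _ he.symm).append_right (w.drop j)
      rwa [List.take_append_drop] at this
    obtain ⟨w', hw', hl⟩ := ih (w.take i ++ w.drop j).length (by simp; omega) _ rfl
    exact ⟨w', e.trans hw', hl⟩

/-! ### Encoding double ascents by binary words. -/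

/-- The positions of the letter `c` in a word, counted from `k`. -/
def positions (c : Bool) : ℕ → List Bool → List ℕ
  | _, [] => []
  | k, a :: w => if a = c then k :: positions c (k + 1) w else positions c (k + 1) w

/-- The permutation encoded by a word: the positions of `true` followed by those of `false`. -/
def wordPerm (w : List Bool) : List ℕ := positions true 1 w ++ positions false 1 w

theorem positions_append (c : Bool) : ∀ (k : ℕ) (u v : List Bool),
    positions c k (u ++ v) = positions c k u ++ positions c (k + u.length) v
  | k, [], v => by simp [positions]
  | k, a :: u, v => by
    simp only [List.cons_append, positions, positions_append c (k + 1) u v, List.length_cons]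
    rw [show k + 1 + u.length = k + (u.length + 1) by omega]
    split <;> simp

theorem positions_add (c : Bool) (d : ℕ) : ∀ (k : ℕ) (w : List Bool),
    positions c (k + d) w = (positions c k w).map (· + d)
  | k, [] => rfl
  | k, a :: w => by
    have := positions_add c d (k + 1) w
    rw [show k + 1 + d = k + d + 1 by omega] at this
    simp only [positions, this]
    split <;> simp

theorem mem_positions {c : Bool} {n : ℕ} : ∀ {k : ℕ} {w : List Bool},
    n ∈ positions c k w ↔ ∃ i, w[i]? = some c ∧ n = k + i
  | k, [] => by simp [positions]
  | k, a :: w => by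
    have ih := @mem_positions c n (k + 1) w
    have : (∃ i, (a :: w)[i]? = some c ∧ n = k + i) ↔
        (a = c ∧ n = k) ∨ ∃ i, w[i]? = some c ∧ n = k + 1 + i := by
      constructor
      · rintro ⟨i, hi, rfl⟩
        cases i with
        | zero => left; simpa using hi
        | succ i => right; exact ⟨i, by simpa using hi, by omega⟩
      · rintro (⟨rfl, rfl⟩ | ⟨i, hi, rfl⟩)
        · exact ⟨0, by simp⟩
        · exact ⟨i + 1, by simpa using hi, by omega⟩
    rw [this, ← ih, positions]
    split <;> simp_all

theorem le_of_mem_positions {c : Bool} {n k : ℕ} {w : List Bool} (h : n ∈ positions c k w) :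
    k ≤ n ∧ n < k + w.length := by
  obtain ⟨i, hi, rfl⟩ := mem_positions.1 h
  have := (List.getElem?_eq_some_iff.1 hi).1
  omega

theorem positions_pairwise (c : Bool) : ∀ (k : ℕ) (w : List Bool),
    (positions c k w).Pairwise (· < ·)
  | _, [] => by simp [positions]
  | k, a :: w => by
    have ih := positions_pairwise c (k + 1) w
    rw [positions]
    split
    · refine List.pairwise_cons.2 ⟨fun n hn => ?_, ih⟩
      have := (le_of_mem_positions hn).1
      omega
    · exact ih

theorem positions_perm_range' : ∀ (k : ℕ) (w : List Bool),
    (positions true k w ++ positions false k w).Perm (List.range' k w.length)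
  | _, [] => by simp [positions]
  | k, a :: w => by
    have ih := positions_perm_range' (k + 1) w
    rw [List.length_cons, List.range'_succ]
    cases a
    · simpa [positions] using List.perm_middle.trans (ih.cons k)
    · simpa [positions] using ih.cons k

theorem wordPerm_perm (w : List Bool) : (wordPerm w).Perm (List.range' 1 w.length) :=
  positions_perm_range' 1 w

@[simp] theorem length_wordPerm (w : List Bool) : (wordPerm w).length = w.length := by
  simpa using (wordPerm_perm w).length_eq

theorem eq_of_positions_eq {u v : List Bool} (hl : u.length = v.length)
    (h : positions true 1 u = positions true 1 v) : u = v := by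
  refine List.ext_getElem hl fun i hi hi' => ?_
  have key : ∀ (w : List Bool) (hi : i < w.length), w[i] = true ↔ 1 + i ∈ positions true 1 w := by
    intro w hi
    rw [mem_positions]
    constructor
    · exact fun hw => ⟨i, by rw [List.getElem?_eq_getElem hi, hw], rfl⟩
    · rintro ⟨j, hj, hij⟩
      obtain rfl : i = j := by omega
      simpa [List.getElem?_eq_getElem hi] using hj
  rw [Bool.eq_iff_iff, key u hi, key v hi', h]

/-- A word has a descent if some `false` is immediately followed by `true`. -/
def HasDescent (w : List Bool) : Prop := [false, true] <:+: w

theorem not_hasDescent_iff {w : List Bool} :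
    ¬ HasDescent w ↔ ∃ i j, w = List.replicate i true ++ List.replicate j false := by
  constructor
  · intro h
    induction w with
    | nil => exact ⟨0, 0, rfl⟩
    | cons a w ih =>
      obtain ⟨i, j, rfl⟩ := ih fun h' => h (List.infix_cons h')
      cases a
      · cases i with
        | zero => exact ⟨0, j + 1, by simp [List.replicate_succ]⟩
        | succ i =>
          exact absurd ⟨[], List.replicate i true ++ List.replicate j false,
            by simp [List.replicate_succ]⟩ h
      · exact ⟨i + 1, j, by simp [List.replicate_succ]⟩
  · rintro ⟨i, j, rfl⟩ h
    induction i with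
    | zero =>
      have := h.subset (show true ∈ [false, true] by simp)
      simp at this
    | succ i ih =>
      rw [List.replicate_succ, List.cons_append, HasDescent, List.infix_cons_iff] at h
      rcases h with h | h
      · simp at h
      · exact ih h

theorem pairwise_wordPerm_iff {w : List Bool} :
    (wordPerm w).Pairwise (· < ·) ↔ ¬ HasDescent w := by
  constructor
  · rintro h ⟨p, q, rfl⟩
    have h1 := (List.pairwise_append.1 h).2.2 (p.length + 2)
      (mem_positions.2 ⟨p.length + 1, by simp, by omega⟩) (p.length + 1)
      (mem_positions.2 ⟨p.length, by simp, by omega⟩)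
    omega
  · intro h
    obtain ⟨i, j, rfl⟩ := not_hasDescent_iff.1 h
    refine List.pairwise_append.2 ⟨positions_pairwise _ _ _, positions_pairwise _ _ _, ?_⟩
    intro m hm n hn
    obtain ⟨a, ha, rfl⟩ := mem_positions.1 hm
    obtain ⟨c, hc, rfl⟩ := mem_positions.1 hn
    rw [List.getElem?_append] at ha hc
    simp only [List.length_replicate] at ha hc
    split at ha <;> split at hc <;> simp_all [List.getElem?_replicate]
    omega

theorem wordPerm_eq_range' {w : List Bool} (h : ¬ HasDescent w) :
    wordPerm w = List.range' 1 w.length :=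
  (wordPerm_perm w).eq_of_pairwise' (pairwise_wordPerm_iff.2 h) List.pairwise_lt_range'

theorem wordPerm_eq_of_not_hasDescent {u v : List Bool} (hu : ¬ HasDescent u)
    (hv : ¬ HasDescent v) (h : u.length = v.length) : wordPerm u = wordPerm v := by
  rw [wordPerm_eq_range' hu, wordPerm_eq_range' hv, h]

theorem length_eq_of_wordPerm_eq {u v : List Bool} (h : wordPerm u = wordPerm v) :
    u.length = v.length := by
  simpa using congrArg List.length h

theorem eq_of_wordPerm_eq {u v : List Bool} (hu : HasDescent u) (h : wordPerm u = wordPerm v) :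
    u = v := by
  have hv : HasDescent v := by
    by_contra hv
    rw [← pairwise_wordPerm_iff, ← h, pairwise_wordPerm_iff] at hv
    exact hv hu
  -- If the first run of `v` properly extended that of `u`, its extra entry would head the second
  -- run of `u` and exceed the first run, making the whole permutation increasing.
  have aux : ∀ {u v : List Bool}, HasDescent u → wordPerm u = wordPerm v →
      ∀ k, positions true 1 u ++ k = positions true 1 v → k = [] := by
    intro u v hu h k hk
    by_contra hk0
    obtain ⟨n, k, rfl⟩ := List.exists_cons_of_ne_nil hk0
    rw [wordPerm, wordPerm, ← hk, List.append_assoc, List.append_cancel_left_eq] at h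
    refine pairwise_wordPerm_iff.1 ?_ hu
    have h1 := positions_pairwise true 1 v
    have h2 := positions_pairwise false 1 u
    rw [← hk] at h1
    rw [h] at h2
    rw [wordPerm, h]
    refine List.pairwise_append.2 ⟨positions_pairwise _ _ _, h2, fun a ha c hc => ?_⟩
    have h3 := (List.pairwise_append.1 h1).2.2 a ha n (by simp)
    simp only [List.cons_append, List.mem_cons] at hc
    rcases hc with rfl | hc
    · exact h3
    · exact h3.trans ((List.pairwise_cons.1 h2).1 c hc)
  refine eq_of_positions_eq (length_eq_of_wordPerm_eq h) ?_
  rcases List.append_eq_append_iff.1 h with ⟨k, hk, _⟩ | ⟨k, hk, _⟩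
  · have := aux hu h k hk.symm
    simp_all
  · have := aux hv h.symm k hk.symm
    simp_all

/-! ### Reduction to short words. -/

/-- The word `z` contains the sequence `β` if some factor of `z` encodes it. -/
def Contains (β : List ℕ) (z : List Bool) : Prop := ∃ u, u <:+: z ∧ wordPerm u = β

theorem Contains.mono {β : List ℕ} {y z : List Bool} (h : Contains β y) (hyz : y <:+: z) :
    Contains β z := by
  obtain ⟨u, hu, rfl⟩ := h
  exact ⟨u, hu.trans hyz, rfl⟩

theorem contains_of_infix {x z : List Bool} (h : x <:+: z) : Contains (wordPerm x) z :=
  ⟨x, h, rfl⟩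

theorem Contains.infix {x z : List Bool} (hx : HasDescent x) (h : Contains (wordPerm x) z) :
    x <:+: z := by
  obtain ⟨u, hu, e⟩ := h
  rwa [eq_of_wordPerm_eq hx e.symm]

theorem Contains.of_localEquiv {b : ℕ} {β : List ℕ} {y z : List Bool} (hb : β.length ≤ b)
    (e : LocalEquiv b y z) (h : Contains β y) : Contains β z := by
  obtain ⟨u, hu, rfl⟩ := h
  exact ⟨u, (e u (by simpa using hb)).2.2.1 hu, rfl⟩

/-- Some word avoiding the sequences in `B` contains both `β` and `γ`. -/
def JointlyContained (B : List (List ℕ)) (β γ : List ℕ) : Prop :=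
  ∃ z, Avoids (wordPerm · ∈ B) z ∧ Contains β z ∧ Contains γ z

theorem JointlyContained.symm {B : List (List ℕ)} {β γ : List ℕ}
    (h : JointlyContained B β γ) : JointlyContained B γ β := by
  obtain ⟨z, hz, h1, h2⟩ := h
  exact ⟨z, hz, h2, h1⟩

theorem JointlyContained.exists_length_le {B : List (List ℕ)} {β γ : List ℕ} {n : ℕ}
    (hB : ∀ β ∈ B, β.length ≤ n) (hβ : β.length ≤ n) (hγ : γ.length ≤ n)
    (h : JointlyContained B β γ) :
    ∃ z, z.length ≤ pumpingBound n ∧ Avoids (wordPerm · ∈ B) z ∧ Contains β z ∧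
      Contains γ z := by
  obtain ⟨z, hz, h1, h2⟩ := h
  obtain ⟨z', e, hl⟩ := exists_localEquiv_length_le n z
  exact ⟨z', hl, e.avoids (fun u hu => by simpa using hB _ hu) hz, h1.of_localEquiv hβ e,
    h2.of_localEquiv hγ e⟩

theorem LocalEquiv.hasDescent {b : ℕ} (hb : 2 ≤ b) {x y : List Bool} (e : LocalEquiv b x y)
    (hx : HasDescent x) : HasDescent y := (e [false, true] hb).2.2.1 hx

theorem HasDescent.mono {x y : List Bool} (h : HasDescent x) (hxy : x <:+: y) : HasDescent y :=
  List.IsInfix.trans h hxy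

theorem localEquiv_replicate {b m n : ℕ} (hm : b ≤ m) (hn : b ≤ n) {α : Type*} (c : α) :
    LocalEquiv b (List.replicate m c) (List.replicate n c) := by
  intro u hu
  simp only [List.prefix_replicate_iff, List.suffix_replicate_iff, List.infix_replicate_iff]
  have h1 := hu.trans hm
  have h2 := hu.trans hn
  simp [h1, h2]

theorem not_hasDescent_replicate (n : ℕ) (c : Bool) : ¬ HasDescent (List.replicate n c) := by
  rw [not_hasDescent_iff]
  cases c
  · exact ⟨0, n, by simp⟩
  · exact ⟨n, 0, by simp⟩

/-- If all short words avoiding `B` are pairwise jointly contained in words avoiding `B`, then so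
are all words avoiding `B`. -/
theorem jointlyContained_of_short {B : List (List ℕ)} {b N : ℕ} (hb : 2 ≤ b)
    (hB : ∀ β ∈ B, β.length ≤ b) (hN : 3 * pumpingBound b + 2 ≤ N) (hbN : 2 * b ≤ N)
    (H : ∀ x y : List Bool, x.length ≤ N → y.length ≤ N → Avoids (wordPerm · ∈ B) x →
      Avoids (wordPerm · ∈ B) y → JointlyContained B (wordPerm x) (wordPerm y))
    (x y : List Bool) (hx : Avoids (wordPerm · ∈ B) x) (hy : Avoids (wordPerm · ∈ B) y) :
    JointlyContained B (wordPerm x) (wordPerm y) := by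
  have hF : ∀ u, wordPerm u ∈ B → u.length ≤ b := fun u hu => by simpa using hB _ hu
  -- Descents make codes unique, so joint containment of permutations here is joinability of words.
  have core : ∀ {x y : List Bool}, Avoids (wordPerm · ∈ B) x → HasDescent x →
      LocalEquiv b x y → Joinable (wordPerm · ∈ B) x y := by
    intro x y hx hdx e
    refine joinable_of_localEquiv (P := HasDescent) (by omega) hF
      (fun x y e => e.hasDescent hb) (exists_localEquiv_length_le b) hN ?_ hx hdx e
    intro x y hx hy hdx hdy hxN hyN
    obtain ⟨z, hz, h1, h2⟩ := H x y hxN hyN hx hy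
    exact ⟨z, hz, h1.infix hdx, h2.infix hdy⟩
  have descent : ∀ {x y : List Bool}, Avoids (wordPerm · ∈ B) x → Avoids (wordPerm · ∈ B) y →
      HasDescent x → HasDescent y → JointlyContained B (wordPerm x) (wordPerm y) := by
    intro x y hx hy hdx hdy
    obtain ⟨x', ex, hx'⟩ := exists_localEquiv_length_le b x
    obtain ⟨y', ey, hy'⟩ := exists_localEquiv_length_le b y
    obtain ⟨z, hz, h1, h2⟩ := H x' y' (by omega) (by omega) (ex.avoids hF hx) (ey.avoids hF hy)
    obtain ⟨p, q, rfl⟩ := h1.infix (ex.hasDescent hb hdx)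
    obtain ⟨p', q', e⟩ := h2.infix (ey.hasDescent hb hdy)
    have e1 : LocalEquiv b (p ++ x ++ q) (p ++ x' ++ q) := (ex.append_left p).append_right q
    have e2 : LocalEquiv b (p' ++ y' ++ q') (p' ++ y ++ q') :=
      (ey.symm.append_left p').append_right q'
    rw [e] at e2
    obtain ⟨z, hz, h1, h2⟩ := core (e1.symm.avoids hF hz)
      (hdx.mono (List.infix_append _ _ _)) (e1.trans e2)
    exact ⟨z, hz, contains_of_infix ((List.infix_append _ _ _).trans h1),
      contains_of_infix ((List.infix_append _ _ _).trans h2)⟩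
  have mixed : ∀ {x y : List Bool}, Avoids (wordPerm · ∈ B) x → Avoids (wordPerm · ∈ B) y →
      ¬ HasDescent x → HasDescent y → JointlyContained B (wordPerm x) (wordPerm y) := by
    intro x y hx hy hdx hdy
    obtain ⟨y', ey, hy'⟩ := exists_localEquiv_length_le b y
    have hdy' := ey.hasDescent hb hdy
    rcases le_total x.length b with hxb | hxb
    · obtain ⟨z, hz, h1, h2⟩ := H x y' (by omega) (by omega) hx (ey.avoids hF hy)
      obtain ⟨p, q, rfl⟩ := h2.infix hdy'
      have e1 : LocalEquiv b (p ++ y' ++ q) (p ++ y ++ q) :=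
        (ey.symm.append_left p).append_right q
      exact ⟨_, e1.avoids hF hz, h1.of_localEquiv (by simpa using hxb) e1,
        contains_of_infix (List.infix_append _ _ _)⟩
    -- `x` already contains every increasing permutation of length at most `b`, so no member of `B`
    -- is increasing.
    · have hid : ∀ w, ¬ HasDescent w → Avoids (wordPerm · ∈ B) w := by
        intro w hw u hu hFu
        refine hx (x.take u.length) (List.take_prefix _ _).isInfix ?_
        change wordPerm _ ∈ B
        rwa [wordPerm_eq_of_not_hasDescent (u := x.take u.length) (v := u)
          (fun h => hdx (h.mono (List.take_prefix _ _).isInfix)) (fun h => hw (h.mono hu))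
          (by simpa using (hF u hFu).trans hxb)]
      obtain ⟨z, hz, ⟨u, hu, hue⟩, h2⟩ := H (List.replicate (2 * b) true) y' (by simpa using hbN)
        (by omega) (hid _ (not_hasDescent_replicate _ _)) (ey.avoids hF hy)
      -- The increasing factor found in `z` may have another code than the one asked for; but of its
      -- two blocks, of total length `2 * b`, one has length at least `b`.
      obtain ⟨c, hc⟩ : ∃ c, List.replicate b c <:+: z := by
        have hdu : ¬ HasDescent u := by
          rw [← pairwise_wordPerm_iff, hue, pairwise_wordPerm_iff]
          exact not_hasDescent_replicate _ _
        have hul := length_eq_of_wordPerm_eq hue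
        obtain ⟨i, j, rfl⟩ := not_hasDescent_iff.1 hdu
        simp only [List.length_append, List.length_replicate] at hul
        rcases le_total b i with hi | hi
        · exact ⟨true, List.IsInfix.trans (List.IsInfix.trans
            (List.infix_replicate_iff.2 (by simpa using hi)) List.infix_append_left) hu⟩
        · exact ⟨false, List.IsInfix.trans (List.IsInfix.trans
            (List.infix_replicate_iff.2 (by simp; omega)) List.infix_append_right) hu⟩
      obtain ⟨p, q, rfl⟩ := h2.infix hdy'
      have e1 : LocalEquiv b (p ++ y' ++ q) (p ++ y ++ q) :=
        (ey.symm.append_left p).append_right q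
      have hz' := e1.avoids hF hz
      rw [(e1 _ (by simp)).2.2] at hc
      obtain ⟨p', q', e⟩ := hc
      -- Scale `b` cannot distinguish constant blocks of length at least `b`, so the block is
      -- stretched to the length of `x`.
      have e2 : LocalEquiv b (p ++ y ++ q) (p' ++ List.replicate x.length c ++ q') := by
        rw [← e]
        exact ((localEquiv_replicate le_rfl hxb c).append_left p').append_right q'
      obtain ⟨z, hz, h1, h2⟩ := core hz' (hdy.mono (List.infix_append _ _ _)) e2
      refine ⟨z, hz, ?_, contains_of_infix ((List.infix_append _ _ _).trans h1)⟩
      rw [wordPerm_eq_of_not_hasDescent hdx (not_hasDescent_replicate x.length c) (by simp)]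
      exact contains_of_infix ((List.infix_append _ _ _).trans h2)
  have increasing : ∀ {x y : List Bool}, Avoids (wordPerm · ∈ B) y → ¬ HasDescent x →
      ¬ HasDescent y → x.length ≤ y.length → JointlyContained B (wordPerm x) (wordPerm y) := by
    intro x y hy hdx hdy hl
    refine ⟨y, hy, ?_, contains_of_infix List.infix_rfl⟩
    rw [wordPerm_eq_of_not_hasDescent (v := y.take x.length) hdx
      (fun h => hdy (h.mono (List.take_prefix _ _).isInfix)) (by simpa using hl)]
    exact contains_of_infix (List.take_prefix _ _).isInfix
  by_cases hdx : HasDescent x <;> by_cases hdy : HasDescent y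
  · exact descent hx hy hdx hdy
  · exact (mixed hy hx hdy hdx).symm
  · exact mixed hx hy hdx hdy
  · rcases le_total x.length y.length with hl | hl
    · exact increasing hy hdx hdy hl
    · exact (increasing hx hdy hdx hl).symm

/-! ### The consecutive order as the factor order. -/

theorem eq_card_filter_le {n : ℕ} {f : Fin n → ℕ} (hf : Function.Injective f)
    (hr : ∀ a, (∃ i, f i = a) ↔ a ∈ Finset.Icc 1 n) (i : Fin n) :
    f i = (Finset.univ.filter fun j => f j ≤ f i).card := by
  rw [← Finset.card_image_of_injective _ hf]
  have : (Finset.univ.filter fun j => f j ≤ f i).image f = Finset.Icc 1 (f i) := by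
    ext a
    simp only [Finset.mem_image, Finset.mem_filter, Finset.mem_univ, true_and]
    have hi := Finset.mem_Icc.1 ((hr (f i)).1 ⟨i, rfl⟩)
    constructor
    · rintro ⟨j, hj, rfl⟩
      exact Finset.mem_Icc.2 ⟨(Finset.mem_Icc.1 ((hr (f j)).1 ⟨j, rfl⟩)).1, hj⟩
    · intro ha
      rw [Finset.mem_Icc] at ha
      obtain ⟨j, rfl⟩ := (hr a).2 (Finset.mem_Icc.2 ⟨ha.1, ha.2.trans hi.2⟩)
      exact ⟨j, ha.2, rfl⟩
  rw [this]
  simp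

theorem get_injective_and_range {τ : List ℕ} (h : τ.Perm (List.range' 1 τ.length)) :
    Function.Injective τ.get ∧ ∀ a, (∃ i, τ.get i = a) ↔ a ∈ Finset.Icc 1 τ.length := by
  refine ⟨List.nodup_iff_injective_get.1 (h.nodup_iff.2 List.nodup_range'), fun a => ?_⟩
  rw [← List.mem_iff_get, h.mem_iff, List.mem_range'_1, Finset.mem_Icc]
  omega

/-- Each entry of a permutation is its own rank, so the relative order determines the permutation.
-/
theorem eq_of_seqIso_map_add {β γ : List ℕ} (d : ℕ) (hβ : β.Perm (List.range' 1 β.length))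
    (hγ : γ.Perm (List.range' 1 γ.length)) (h : SeqIso β (γ.map (· + d))) : β = γ := by
  obtain ⟨hl, h⟩ := h
  have hl' : β.length = γ.length := by simpa using hl
  obtain ⟨h1, h2⟩ := get_injective_and_range hβ
  obtain ⟨h3, h4⟩ := get_injective_and_range hγ
  have key : β.get = fun i => γ.get (i.cast hl') := by
    funext i
    rw [eq_card_filter_le h1 h2 i,
      eq_card_filter_le (f := fun i => γ.get (i.cast hl')) (fun i j hij => by simpa using h3 hij)
        (fun a => ?_) i]
    · congr 1
      refine Finset.filter_congr fun j _ => ?_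
      have := h i j
      simp only [List.get_eq_getElem, Fin.val_cast, List.getElem_map, add_lt_add_iff_right] at this
      rw [← not_lt, ← not_lt]
      exact not_congr this
    · rw [show Finset.Icc 1 β.length = Finset.Icc 1 γ.length by rw [hl'], ← h4 a]
      exact ⟨fun ⟨i, hi⟩ => ⟨_, hi⟩, fun ⟨i, hi⟩ => ⟨i.cast hl'.symm, hi⟩⟩
  refine List.ext_getElem hl' fun i hi hi' => ?_
  exact congrFun key ⟨i, hi⟩

theorem restrict_wordPerm (p u q : List Bool) :
    restrict (wordPerm (p ++ u ++ q)) (Finset.Icc (p.length + 1) (p.length + u.length)) =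
      (wordPerm u).map (· + p.length) := by
  have key : ∀ c, (positions c 1 (p ++ u ++ q)).filter
      (fun x => x ∈ Finset.Icc (p.length + 1) (p.length + u.length)) =
      (positions c 1 u).map (· + p.length) := by
    intro c
    rw [positions_append, positions_append, List.filter_append, List.filter_append,
      List.filter_eq_nil_iff.2, List.filter_eq_self.2, List.filter_eq_nil_iff.2]
    · simp [positions_add]
    · intro a ha
      have := le_of_mem_positions ha
      simp at this ⊢
      omega
    · intro a ha
      have := le_of_mem_positions ha
      simp at this ⊢
      omega
    · intro a ha
      have := le_of_mem_positions ha
      simp at this ⊢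
      omega
  rw [restrict, wordPerm, List.filter_append, key, key, wordPerm, List.map_append]

theorem image_Icc_of_contiguous {n m : ℕ} {f : ℕ → ℕ} (h : IsContiguous n m f) :
    (Finset.Icc 1 n).image f = Finset.Icc (f 1 - 1 + 1) (f 1 - 1 + n) := by
  ext a
  rw [Finset.mem_image, Finset.mem_Icc]
  constructor
  · rintro ⟨k, hk, rfl⟩
    have h1 := (h k hk).2
    rw [Finset.mem_Icc] at hk
    have h2 := Finset.mem_Icc.1 (h 1 (Finset.mem_Icc.2 ⟨le_rfl, by omega⟩)).1
    omega
  · intro ha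
    have h2 := Finset.mem_Icc.1 (h 1 (Finset.mem_Icc.2 ⟨le_rfl, by omega⟩)).1
    have hk : a + 1 - f 1 ∈ Finset.Icc 1 n := Finset.mem_Icc.2 ⟨by omega, by omega⟩
    exact ⟨a + 1 - f 1, hk, by have := (h _ hk).2; omega⟩

theorem consecutiveLE_wordPerm_iff {β : List ℕ} (hβ : IsPermutation β) (z : List Bool) :
    ConsecutiveLE β (wordPerm z) ↔ Contains β z := by
  have hn : 1 ≤ β.length := List.length_pos_iff.2 hβ.1
  constructor
  · rintro ⟨f, hf, hiso⟩
    rw [image_Icc_of_contiguous hf] at hiso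
    have h1 := Finset.mem_Icc.1 (hf 1 (Finset.mem_Icc.2 ⟨le_rfl, hn⟩)).1
    have h2 := hf β.length (Finset.mem_Icc.2 ⟨hn, le_rfl⟩)
    rw [Finset.mem_Icc, length_wordPerm] at h2
    set c := f 1 - 1 with hc
    set u := (z.drop c).take β.length with hu
    have hz : z = z.take c ++ u ++ (z.drop c).drop β.length := by
      rw [List.append_assoc, List.take_append_drop, List.take_append_drop]
    have hpl : (z.take c).length = c := by simp; omega
    have hul : u.length = β.length := by simp [hu]; omega
    have := restrict_wordPerm (z.take c) u ((z.drop c).drop β.length)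
    rw [← hz, hpl, hul] at this
    rw [this] at hiso
    refine ⟨u, ⟨_, _, hz.symm⟩, (eq_of_seqIso_map_add c hβ.2 ?_ hiso).symm⟩
    rw [length_wordPerm]
    exact wordPerm_perm u
  · rintro ⟨u, ⟨p, q, rfl⟩, rfl⟩
    have hf : IsContiguous (wordPerm u).length (wordPerm (p ++ u ++ q)).length
        (fun k => p.length + k) := by
      intro k hk
      simp only [length_wordPerm, Finset.mem_Icc, List.length_append] at hk ⊢
      omega
    refine ⟨_, hf, ?_⟩
    have h1 := restrict_wordPerm p u q
    rw [image_Icc_of_contiguous hf, length_wordPerm, Nat.add_sub_cancel, h1]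
    exact ⟨by simp, fun i j => by simp⟩

theorem lt_of_infix_pair {A : List ℕ} (hA : A.Pairwise (· < ·)) {a b : ℕ} (h : [a, b] <:+: A) :
    a < b := by
  simpa using hA.sublist h.sublist

theorem isDoubleAscent_wordPerm {w : List Bool} (hw : w ≠ []) : IsDoubleAscent (wordPerm w) := by
  refine ⟨⟨?_, ?_⟩, ?_⟩
  · intro h
    have := congrArg List.length h
    rw [length_wordPerm] at this
    simp_all
  · rw [length_wordPerm]
    exact wordPerm_perm w
  -- Both runs increase, so an inversion can only straddle their junction.
  · have key : ∀ p, IsConsecutiveInversion (wordPerm w) p →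
        [p.1] <:+ positions true 1 w ∧ [p.2] <+: positions false 1 w := by
      rintro ⟨a, b⟩ ⟨h, hba⟩
      simp only at h hba ⊢
      rw [wordPerm, List.infix_append_iff] at h
      have hn : ∀ c, ¬ [a, b] <:+: positions c 1 w := fun c hc =>
        absurd (lt_of_infix_pair (positions_pairwise c 1 w) hc) (not_lt.2 hba)
      rcases h with h | h | ⟨r, r', e, hr, hr'⟩
      · exact absurd h (hn _)
      · exact absurd h (hn _)
      · match r, r', e with
        | [], _, e => exact absurd (by rw [e]; exact hr'.isInfix) (hn false)
        | [_], _, e =>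
          simp only [List.cons_append, List.nil_append, List.cons.injEq] at e
          obtain ⟨rfl, rfl⟩ := e
          exact ⟨hr, hr'⟩
        | [_, _], [], e => exact absurd (by rw [e, List.append_nil]; exact hr.isInfix) (hn true)
    rw [Set.encard_le_one_iff]
    rintro p p' hp hp'
    obtain ⟨h1, h2⟩ := key p hp
    obtain ⟨h3, h4⟩ := key p' hp'
    have e1 := (List.suffix_of_suffix_length_le h1 h3 (by simp)).eq_of_length (by simp)
    have e2 := (List.prefix_of_prefix_length_le h2 h4 (by simp)).eq_of_length (by simp)
    simp only [List.cons.injEq, and_true] at e1 e2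
    exact Prod.ext e1 e2

theorem pairwise_lt_of_forall_infix_pair : ∀ {l : List ℕ},
    (∀ a b, [a, b] <:+: l → a < b) → l.Pairwise (· < ·)
  | [], _ => List.Pairwise.nil
  | [_], _ => List.pairwise_singleton _ _
  | x :: y :: l, h => by
    have ih := pairwise_lt_of_forall_infix_pair (l := y :: l)
      fun a b hab => h a b (List.infix_cons hab)
    have hxy := h x y ⟨[], l, rfl⟩
    refine List.pairwise_cons.2 ⟨fun a ha => ?_, ih⟩
    rcases List.mem_cons.1 ha with rfl | ha
    · exact hxy
    · exact hxy.trans ((List.pairwise_cons.1 ih).1 a ha)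

theorem exists_increasing_split : ∀ {σ : List ℕ}, σ.Nodup →
    (∀ p p', IsConsecutiveInversion σ p → IsConsecutiveInversion σ p' → p = p') →
    ∃ A B, σ = A ++ B ∧ A.Pairwise (· < ·) ∧ B.Pairwise (· < ·)
  | [], _, _ => ⟨[], [], rfl, .nil, .nil⟩
  | [x], _, _ => ⟨[x], [], rfl, List.pairwise_singleton _ _, .nil⟩
  | x :: y :: σ, hn, h => by
    rcases le_or_gt y x with hyx | hxy
    · refine ⟨[x], y :: σ, rfl, List.pairwise_singleton _ _,
        pairwise_lt_of_forall_infix_pair fun a b hab => ?_⟩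
      by_contra! hba
      have e := h (x, y) (a, b) ⟨⟨[], σ, rfl⟩, hyx⟩ ⟨List.infix_cons hab, hba⟩
      simp only [Prod.mk.injEq] at e
      exact (List.nodup_cons.1 hn).1 (e.1 ▸ hab.subset (by simp))
    · obtain ⟨A, B, e, hA, hB⟩ := exists_increasing_split (List.nodup_cons.1 hn).2
        fun p p' hp hp' => h p p' ⟨List.infix_cons hp.1, hp.2⟩ ⟨List.infix_cons hp'.1, hp'.2⟩
      cases A with
      | nil => exact ⟨[x], B, by rw [e]; rfl, List.pairwise_singleton _ _, hB⟩
      | cons z A =>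
        obtain ⟨rfl, e⟩ := List.cons.inj e
        refine ⟨x :: y :: A, B, by rw [e]; rfl, List.pairwise_cons.2 ⟨fun a ha => ?_, hA⟩, hB⟩
        rcases List.mem_cons.1 ha with rfl | ha
        · exact hxy
        · exact hxy.trans ((List.pairwise_cons.1 hA).1 a ha)

theorem exists_wordPerm_eq {σ : List ℕ} (h : IsDoubleAscent σ) : ∃ w, wordPerm w = σ := by
  obtain ⟨⟨h0, hp⟩, hd⟩ := h
  rw [Set.encard_le_one_iff] at hd
  have hnd : σ.Nodup := hp.nodup_iff.2 List.nodup_range'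
  obtain ⟨A, B, e, hA, hB⟩ := exists_increasing_split hnd fun p p' hp hp' => hd p p' hp hp'
  have hmem : ∀ a, a ∈ σ ↔ 1 ≤ a ∧ a < 1 + σ.length := fun a => by
    rw [hp.mem_iff, List.mem_range'_1]
  let w : List Bool := List.ofFn fun i : Fin σ.length => decide (1 + (i : ℕ) ∈ A)
  have hw : ∀ c a, a ∈ positions c 1 w ↔ a ∈ σ ∧ decide (a ∈ A) = c := by
    intro c a
    rw [mem_positions, hmem]
    constructor
    · rintro ⟨i, hi, rfl⟩
      obtain ⟨hl, hi⟩ := List.getElem?_eq_some_iff.1 hi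
      simp only [w, List.length_ofFn, List.getElem_ofFn] at hl hi
      exact ⟨by omega, hi⟩
    · rintro ⟨hl, hc⟩
      obtain ⟨i, rfl⟩ := Nat.exists_eq_add_of_le hl.1
      refine ⟨i, List.getElem?_eq_some_iff.2 ⟨by simp [w]; omega, ?_⟩, rfl⟩
      simpa [w] using hc
  have hdisj := List.disjoint_of_nodup_append (e ▸ hnd)
  refine ⟨w, ?_⟩
  rw [wordPerm, e]
  congr 1
  · refine (positions_pairwise true 1 w).eq_of_mem_iff hA fun a => ?_
    rw [hw, e]
    simp +contextual
  · refine (positions_pairwise false 1 w).eq_of_mem_iff hB fun a => ?_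
    rw [hw, e]
    simp only [List.mem_append, decide_eq_false_iff_not]
    constructor
    · rintro ⟨h | h, h'⟩
      · exact absurd h h'
      · exact h
    · exact fun h => ⟨Or.inr h, fun h' => hdisj h' h⟩

/-! ### Atomicity as directedness. -/

/-- The double ascent encoded by a nonempty word. -/
def DoubleAscent.ofWord (w : List Bool) (hw : w ≠ []) : DoubleAscent :=
  ⟨wordPerm w, isDoubleAscent_wordPerm hw⟩

theorem DoubleAscent.exists_ofWord (σ : DoubleAscent) : ∃ w hw, σ = ofWord w hw := by
  obtain ⟨w, hw⟩ := exists_wordPerm_eq σ.2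
  refine ⟨w, ?_, Subtype.ext hw.symm⟩
  rintro rfl
  exact σ.2.1.1 hw.symm

theorem DoubleAscent.le_ofWord_iff {σ : DoubleAscent} {w : List Bool} {hw : w ≠ []} :
    σ ≤ ofWord w hw ↔ Contains σ.oneLine w :=
  consecutiveLE_wordPerm_iff σ.2.1 w

instance : Preorder DoubleAscent where
  le_refl σ := by
    obtain ⟨w, hw, rfl⟩ := σ.exists_ofWord
    exact DoubleAscent.le_ofWord_iff.2 (contains_of_infix List.infix_rfl)
  le_trans σ ρ τ h h' := by
    obtain ⟨z, hz, rfl⟩ := τ.exists_ofWord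
    obtain ⟨v, hv, e⟩ := DoubleAscent.le_ofWord_iff.1 h'
    have hv0 : v ≠ [] := by
      rintro rfl
      exact ρ.2.1.1 e.symm
    obtain rfl : DoubleAscent.ofWord v hv0 = ρ := Subtype.ext e
    exact DoubleAscent.le_ofWord_iff.2 ((DoubleAscent.le_ofWord_iff.1 h).mono hv)

theorem isLowerSet_av {α : Type*} [Preorder α] (B : Set α) : IsLowerSet (Av B) :=
  fun _ _ hyx hx b hb hby => hx b hb (hby.trans hyx)

theorem isAtomicSet_iff_directedOn {α : Type*} [Preorder α] {Y : Set α} (hY : IsLowerSet Y) :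
    IsAtomicSet Y ↔ DirectedOn (· ≤ ·) Y := by
  constructor
  · rintro ⟨_, h⟩ x hx y hy
    by_contra! hc
    -- With no common upper bound in `Y`, every element fails to lie above `x` or above `y`.
    refine h ⟨{z ∈ Y | ¬ x ≤ z}, {z ∈ Y | ¬ y ≤ z}, ?_, ?_, ?_, ?_, ?_⟩
    · exact fun a b hba ha => ⟨hY hba ha.1, fun h => ha.2 (h.trans hba)⟩
    · exact fun a b hba ha => ⟨hY hba ha.1, fun h => ha.2 (h.trans hba)⟩
    · exact ⟨fun z hz => hz.1, fun h => (h hx).2 le_rfl⟩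
    · exact ⟨fun z hz => hz.1, fun h => (h hy).2 le_rfl⟩
    · ext z
      have := hc z
      simp only [Set.mem_union, Set.mem_ofPred_eq]
      tauto
  · refine fun h => ⟨hY, ?_⟩
    rintro ⟨U, V, hU, hV, hUY, hVY, e⟩
    obtain ⟨x, hx, hxU⟩ := Set.exists_of_ssubset hUY
    obtain ⟨y, hy, hyV⟩ := Set.exists_of_ssubset hVY
    obtain ⟨z, hz, hxz, hyz⟩ := h x hx y hy
    rcases e ▸ hz with hz | hz
    · exact hxU (hU hxz hz)
    · exact hyV (hV hyz hz)

theorem DoubleAscent.ofWord_mem_av_iff {B : List DoubleAscent} {w : List Bool} {hw : w ≠ []} :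
    ofWord w hw ∈ Av {b | b ∈ B} ↔ Avoids (wordPerm · ∈ B.map oneLine) w := by
  simp only [Av, Set.mem_ofPred_eq, le_ofWord_iff, Avoids, List.mem_map, not_exists, not_and]
  constructor
  · exact fun h u hu b hb e => h b hb ⟨u, hu, e.symm⟩
  · rintro h b hb ⟨u, hu, e⟩
    exact h u hu b hb e.symm

theorem isAtomicSet_av_iff (B : List DoubleAscent) :
    IsAtomicSet (Av {b | b ∈ B}) ↔ ∀ x y : List Bool,
      Avoids (wordPerm · ∈ B.map DoubleAscent.oneLine) x →
      Avoids (wordPerm · ∈ B.map DoubleAscent.oneLine) y →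
      JointlyContained (B.map DoubleAscent.oneLine) (wordPerm x) (wordPerm y) := by
  rw [isAtomicSet_iff_directedOn (isLowerSet_av _)]
  constructor
  · intro h x y hx hy
    rcases eq_or_ne x [] with rfl | hx0
    · exact ⟨y, hy, ⟨[], by simp, rfl⟩, contains_of_infix List.infix_rfl⟩
    rcases eq_or_ne y [] with rfl | hy0
    · exact ⟨x, hx, contains_of_infix List.infix_rfl, ⟨[], by simp, rfl⟩⟩
    obtain ⟨ζ, hζ, h1, h2⟩ := h (.ofWord x hx0) (DoubleAscent.ofWord_mem_av_iff.2 hx)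
      (.ofWord y hy0) (DoubleAscent.ofWord_mem_av_iff.2 hy)
    obtain ⟨z, hz, rfl⟩ := ζ.exists_ofWord
    exact ⟨z, DoubleAscent.ofWord_mem_av_iff.1 hζ, DoubleAscent.le_ofWord_iff.1 h1,
      DoubleAscent.le_ofWord_iff.1 h2⟩
  · intro h σ hσ ρ hρ
    obtain ⟨x, hx, rfl⟩ := σ.exists_ofWord
    obtain ⟨y, hy, rfl⟩ := ρ.exists_ofWord
    obtain ⟨z, hz, h1, h2⟩ := h x y (DoubleAscent.ofWord_mem_av_iff.1 hσ)
      (DoubleAscent.ofWord_mem_av_iff.1 hρ)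
    have hz0 : z ≠ [] := by
      rintro rfl
      obtain ⟨u, hu, e⟩ := h1
      rw [List.infix_nil] at hu
      subst hu
      have := length_eq_of_wordPerm_eq e
      simp only [List.length_nil] at this
      exact hx (List.length_eq_zero_iff.1 this.symm)
    exact ⟨.ofWord z hz0, DoubleAscent.ofWord_mem_av_iff.2 hz,
      DoubleAscent.le_ofWord_iff.2 h1, DoubleAscent.le_ofWord_iff.2 h2⟩

/-! ### Primitive recursiveness. -/

theorem positions_eq_foldr (c : Bool) (w : List Bool) :
    positions c 1 w =
      w.foldr (fun a l => (if a = c then [1] else []) ++ l.map Nat.succ) [] := by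
  induction w with
  | nil => rfl
  | cons a w ih =>
    -- Shifting the positions of the tail by one replaces the running index, leaving a plain fold.
    rw [List.foldr_cons, ← ih, positions, positions_add c 1 1 w]
    split <;> rfl

theorem primrec_positions (c : Bool) : Primrec (positions c 1) := by
  refine Primrec.of_eq (f := fun w : List Bool => w.foldr
    (fun a l => (if a = c then [1] else []) ++ l.map Nat.succ) []) ?_
    fun w => (positions_eq_foldr c w).symm
  refine Primrec.list_foldr (h := fun _ p => (if p.1 = c then [1] else []) ++ p.2.map Nat.succ)
    Primrec.id (Primrec.const []) ?_
  refine Primrec.list_append.comp ?_ ?_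
  · exact (Primrec.dom_bool fun a => if a = c then [1] else []).comp
      (Primrec.fst.comp Primrec.snd)
  · exact Primrec.list_map (Primrec.snd.comp Primrec.snd) (Primrec.succ.comp Primrec.snd)

theorem primrec_wordPerm : Primrec wordPerm :=
  Primrec.list_append.comp (primrec_positions true) (primrec_positions false)

theorem primrec_wordsUpTo : Primrec wordsUpTo := by
  refine Primrec.of_eq (f := fun n => Nat.rec [[]]
    (fun _ l => [] :: l.flatMap fun w => [true :: w, false :: w]) n) ?_ fun n => ?_
  · refine Primrec.nat_rec₁ _ ?_
    refine Primrec.list_cons.comp (Primrec.const []) (Primrec.list_flatMap Primrec.snd ?_)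
    refine Primrec.list_cons.comp (Primrec.list_cons.comp (Primrec.const true) Primrec.snd)
      (Primrec.list_cons.comp (Primrec.list_cons.comp (Primrec.const false) Primrec.snd)
        (Primrec.const []))
  · induction n with
    | zero => rfl
    | succ n ih => simp only [wordsUpTo, ← ih]

theorem primrec_pumpingBound : Primrec pumpingBound := by
  have h : Primrec fun n : ℕ => 8 ^ n := by
    refine Primrec.of_eq (f := fun n => Nat.rec 1 (fun _ m => m * 8) n)
      (Primrec.nat_rec₁ (f := fun _ m => m * 8) 1
        (Primrec.nat_mul.comp Primrec.snd (Primrec.const 8))) fun n => ?_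
    induction n with
    | zero => rfl
    | succ n ih => rw [pow_succ, ← ih]
  exact h.comp (Primrec.list_length.comp primrec_wordsUpTo)

section Quantifiers

variable {α β : Type*} [Primcodable α] [Primcodable β]

theorem primrecPred_exists_mem {f : α → List β} {R : β → α → Prop} (hf : Primrec f)
    (hR : PrimrecPred fun p : β × α => R p.1 p.2) : PrimrecPred fun a => ∃ b ∈ f a, R b a :=
  PrimrecRel.comp (R := fun (L : List β) a => ∃ b ∈ L, R b a)
    (PrimrecRel.exists_mem_list hR) hf Primrec.id

theorem primrecPred_forall_mem {f : α → List β} {R : β → α → Prop} (hf : Primrec f)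
    (hR : PrimrecPred fun p : β × α => R p.1 p.2) : PrimrecPred fun a => ∀ b ∈ f a, R b a :=
  PrimrecRel.comp (R := fun (L : List β) a => ∀ b ∈ L, R b a)
    (PrimrecRel.forall_mem_list hR) hf Primrec.id

theorem primrecPred_imp {p q : α → Prop} (hp : PrimrecPred p) (hq : PrimrecPred q) :
    PrimrecPred fun a => p a → q a :=
  (hp.not.or hq).of_eq fun _ => imp_iff_not_or.symm

end Quantifiers

theorem contains_iff_exists_mem {β : List ℕ} {z : List Bool} :
    Contains β z ↔ ∃ u ∈ wordsUpTo z.length, ∃ p ∈ wordsUpTo z.length,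
      ∃ q ∈ wordsUpTo z.length, p ++ u ++ q = z ∧ wordPerm u = β := by
  simp only [mem_wordsUpTo]
  constructor
  · rintro ⟨u, ⟨p, q, rfl⟩, rfl⟩
    exact ⟨u, by simp; omega, p, by simp, q, by simp; omega, rfl, rfl⟩
  · rintro ⟨u, _, p, _, q, _, rfl, rfl⟩
    exact ⟨u, ⟨p, q, rfl⟩, rfl⟩

theorem primrecRel_contains : PrimrecRel Contains := by
  refine PrimrecPred.of_eq ?_ fun p => contains_iff_exists_mem.symm
  have hw : Primrec fun p : List ℕ × List Bool => wordsUpTo p.2.length :=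
    primrec_wordsUpTo.comp (Primrec.list_length.comp Primrec.snd)
  refine primrecPred_exists_mem hw (primrecPred_exists_mem (hw.comp Primrec.snd)
    (primrecPred_exists_mem (hw.comp (Primrec.snd.comp Primrec.snd)) (PrimrecPred.and ?_ ?_)))
  · exact Primrec.eq.comp (Primrec.list_append.comp (Primrec.list_append.comp
      (Primrec.fst.comp Primrec.snd) (Primrec.fst.comp (Primrec.snd.comp Primrec.snd)))
      Primrec.fst) (Primrec.snd.comp (Primrec.snd.comp (Primrec.snd.comp Primrec.snd)))
  · exact Primrec.eq.comp (primrec_wordPerm.comp (Primrec.fst.comp (Primrec.snd.comp Primrec.snd)))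
      (Primrec.fst.comp (Primrec.snd.comp (Primrec.snd.comp Primrec.snd)))

theorem avoids_iff_forall_not_contains {B : List (List ℕ)} {z : List Bool} :
    Avoids (wordPerm · ∈ B) z ↔ ∀ β ∈ B, ¬ Contains β z := by
  constructor
  · rintro h β hβ ⟨u, hu, rfl⟩
    exact h u hu hβ
  · exact fun h u hu hB => h _ hB ⟨u, hu, rfl⟩

theorem primrecRel_avoids :
    PrimrecRel fun (B : List (List ℕ)) (z : List Bool) => Avoids (wordPerm · ∈ B) z :=
  (PrimrecRel.forall_mem_list primrecRel_contains.not).of_eq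
    fun _ _ => avoids_iff_forall_not_contains.symm

/-! ### The bounded test. -/

/-- A length scale exceeding the lengths of all sequences in `B`. -/
def scale (B : List (List ℕ)) : ℕ := B.flatten.length + 2

/-- It suffices to test joint containment for words up to this length. -/
def testBound (B : List (List ℕ)) : ℕ := 3 * pumpingBound (scale B) + 2 + 2 * scale B

theorem length_le_scale {B : List (List ℕ)} {β : List ℕ} (h : β ∈ B) : β.length ≤ scale B :=
  (List.infix_of_mem_flatten h).length_le.trans (Nat.le_add_right _ _)

/-- A bounded search that tests whether `Av B` is atomic. -/
def AtomicTest (B : List (List ℕ)) : Prop :=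
  ∀ x ∈ wordsUpTo (testBound B), ∀ y ∈ wordsUpTo (testBound B),
    Avoids (wordPerm · ∈ B) x → Avoids (wordPerm · ∈ B) y →
      ∃ z ∈ wordsUpTo (pumpingBound (testBound B)), Avoids (wordPerm · ∈ B) z ∧
        Contains (wordPerm x) z ∧ Contains (wordPerm y) z

theorem atomicTest_iff (B : List (List ℕ)) :
    AtomicTest B ↔ ∀ x y : List Bool, Avoids (wordPerm · ∈ B) x → Avoids (wordPerm · ∈ B) y →
      JointlyContained B (wordPerm x) (wordPerm y) := by
  simp only [AtomicTest, mem_wordsUpTo]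
  have hs : scale B ≤ testBound B := by unfold testBound; omega
  constructor
  · intro h
    refine jointlyContained_of_short (b := scale B) (N := testBound B) (Nat.le_add_left _ _)
      (fun β => length_le_scale) (Nat.le_add_right _ _) (Nat.le_add_left _ _) ?_
    intro x y hx hy hax hay
    obtain ⟨z, _, h⟩ := h x hx y hy hax hay
    exact ⟨z, h⟩
  · intro h x hx y hy hax hay
    -- The witness is shrunk at scale `testBound B` rather than `scale B`, because it must keep its
    -- factors encoding the permutations of `x` and `y`.
    exact (h x y hax hay).exists_length_le (fun β hβ => (length_le_scale hβ).trans hs)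
      (by simpa using hx) (by simpa using hy)

theorem primrecPred_atomicTest : PrimrecPred AtomicTest := by
  have hscale : Primrec scale :=
    Primrec.nat_add.comp (Primrec.list_length.comp Primrec.list_flatten) (Primrec.const 2)
  have htest : Primrec testBound :=
    Primrec.nat_add.comp (Primrec.nat_add.comp (Primrec.nat_mul.comp (Primrec.const 3)
      (primrec_pumpingBound.comp hscale)) (Primrec.const 2))
      (Primrec.nat_mul.comp (Primrec.const 2) hscale)
  have hw : Primrec fun B => wordsUpTo (testBound B) := primrec_wordsUpTo.comp htest
  have hz : Primrec fun B => wordsUpTo (pumpingBound (testBound B)) :=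
    primrec_wordsUpTo.comp (primrec_pumpingBound.comp htest)
  have hB : Primrec fun p : List Bool × List Bool × List (List ℕ) => p.2.2 :=
    Primrec.snd.comp Primrec.snd
  refine primrecPred_forall_mem hw (primrecPred_forall_mem (hw.comp Primrec.snd)
    (primrecPred_imp ?_ (primrecPred_imp ?_ (primrecPred_exists_mem (hz.comp hB)
      (PrimrecPred.and ?_ (PrimrecPred.and ?_ ?_))))))
  · exact primrecRel_avoids.comp hB (Primrec.fst.comp Primrec.snd)
  · exact primrecRel_avoids.comp hB Primrec.fst
  · exact primrecRel_avoids.comp (hB.comp Primrec.snd) Primrec.fst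
  · exact primrecRel_contains.comp
      (primrec_wordPerm.comp (Primrec.fst.comp (Primrec.snd.comp Primrec.snd))) Primrec.fst
  · exact primrecRel_contains.comp
      (primrec_wordPerm.comp (Primrec.fst.comp Primrec.snd)) Primrec.fst

end ConsecutiveOrder

/-- There is an algorithm which, given the list of the one-line notations of the members of any
finite set `B` of double ascents, decides whether `Av(B)` is atomic. -/
theorem mainTheorem12 :
    ∃ decideAtomic : List (List ℕ) → Bool, Computable decideAtomic ∧
      ∀ B : List ConsecutiveOrder.DoubleAscent,
        decideAtomic (B.map ConsecutiveOrder.DoubleAscent.oneLine) = true ↔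
          ConsecutiveOrder.IsAtomicSet (ConsecutiveOrder.Av {b | b ∈ B}) := by
  obtain ⟨_, h⟩ := ConsecutiveOrder.primrecPred_atomicTest
  refine ⟨_, h.to_comp, fun B => ?_⟩
  rw [decide_eq_true_iff, ConsecutiveOrder.atomicTest_iff, ConsecutiveOrder.isAtomicSet_av_iff]
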